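/- There is an absolute constant $C>0$ such that for every dimension $d$ and every $\epsilon>0$ there are a number $n\le C\,d^2/\epsilon^2$, an independent (non-adaptive, single-copy) measurement on $2n$ systems $\mathbb{C}^d$, that is, a POVM of the form $\bigotimes_{k=1}^{2n}\mathcal{M}^{(k)}$ with each $\mathcal{M}^{(k)}$ a POVM on $\mathbb{C}^d$ with finitely many outcomes, and a rule that turns its outcome into the answer "Yes" or "No", all depending only on $d$ and $\epsilon$, with the following property. For all density operators $\rho,\sigma\in\mathcal{D}(\mathbb{C}^d)$ (positive semidefinite, trace one), when the measurement is performed on $n$ copies of $\rho$ and $n$ copies of $\sigma$, i.e. on the state $\rho^{\otimes n}\otimes\sigma^{\otimes n}$: if $\rho=\sigma$, then the answer is "Yes" with probability at least $2/3$; if $\|\rho-\sigma\|_1>\epsilon$, where $\|A\|_1=\mathrm{Tr}\sqrt{A^\dagger A}$, then the answer is "No" with probability at least $2/3$. -/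

import Mathlib

open scoped MatrixOrder ComplexOrder

/-- The set `𝒟(ℂ^X)` of density operators, as matrices in the standard basis. -/
def densityOperators (X : Type) [Fintype X] : Set (Matrix X X ℂ) :=
  {ρ | ρ.PosSemidef ∧ ρ.trace = 1}

/-- The trace norm `‖A‖₁ = Tr |A|`, where `|A| = √(A† A)` is the positive square root. -/
noncomputable def traceNorm {X : Type} [Fintype X] [DecidableEq X] (A : Matrix X X ℂ) : ℝ :=
  (CFC.abs A).trace.re

/-- The tensor product `⨂ₖ Aₖ` of operators on `ℂ^X`, as an operator on
`(ℂ^X)^{⊗ ι} = ℂ^(ι → X)`, given by its matrix in the product basis. -/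
def tensorOp {ι X : Type} [Fintype ι] (A : ι → Matrix X X ℂ) : Matrix (ι → X) (ι → X) ℂ :=
  Matrix.of fun x y => ∏ k, A k (x k) (y k)

/-- A measurement (POVM) on `ℂ^X` with finite outcome set `Ω`. -/
structure POVM (X Ω : Type) [Fintype X] [DecidableEq X] [Fintype Ω] where
  /-- The operator `M_ω` belonging to the outcome `ω`. -/
  effect : Ω → Matrix X X ℂ
  posSemidef : ∀ ω, (effect ω).PosSemidef
  sum_effect : ∑ ω, effect ω = 1

namespace POVM

/-- The probability `Tr (M_ω ρ)` of the outcome `ω` when `M` is performed on the state `ρ`. -/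
noncomputable def prob {X Ω : Type} [Fintype X] [DecidableEq X] [Fintype Ω]
    (M : POVM X Ω) (ρ : Matrix X X ℂ) (ω : Ω) : ℝ :=
  (M.effect ω * ρ).trace.re

/-- A measurement on a family (indexed by `ι`) of systems `ℂ^X` is independent if it is a tensor
product `⨂ₖ M⁽ᵏ⁾` of measurements `M⁽ᵏ⁾` on the individual systems, fixed in advance. -/
def IsIndependent {ι X Ω : Type} [Fintype ι] [DecidableEq ι] [Fintype X] [DecidableEq X]
    [Fintype Ω] (M : POVM (ι → X) (ι → Ω)) : Prop :=
  ∃ N : ι → POVM X Ω, ∀ ω : ι → Ω, M.effect ω = tensorOp fun k => (N k).effect (ω k)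

/-- The probability that the answer is `b` when `M` is performed on the state `ρ` and its outcome
`ω` is turned into the answer `decision ω`. -/
noncomputable def answerProb {X Ω : Type} [Fintype X] [DecidableEq X] [Fintype Ω]
    (M : POVM X Ω) (decision : Ω → Bool) (ρ : Matrix X X ℂ) (b : Bool) : ℝ :=
  ∑ ω with decision ω = b, M.prob ρ ω

end POVM

/-- The joint state `ρ^{⊗ n} ⊗ σ^{⊗ n}` of `n` copies of `ρ` and `n` copies of `σ`. -/
def copies {X : Type} (n : ℕ) (ρ σ : Matrix X X ℂ) :
    Matrix (Fin n ⊕ Fin n → X) (Fin n ⊕ Fin n → X) ℂ :=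
  tensorOp (Sum.elim (fun _ => ρ) (fun _ => σ))

/-! Every copy is measured with one fixed POVM that acts as a 2-design, which reduces the problem to
classical `ℓ²` closeness testing. For a prime `p` slightly above `d`, take `p + 1` mutually unbiased
bases of `ℂ^p` and compress them to `ℂ^d`. With `L = p + 1`, `∑ (Tr M_ω A)² = ((Tr A)² + Tr A²) /
L²` (`sum_trace_unbiasedPOVM_sq`). So each outcome law has squared `ℓ²` norm at most `2 / L²`, while
the laws `p`, `q` of `ρ`, `σ` satisfy `‖p - q‖² = Tr (ρ - σ)² / L²`, which exceeds `τ = ε² / (d L²)`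
for far states by Cauchy–Schwarz.

The tester splits the samples into two independent halves and pairs their vectors of count
differences. The mean is `r² ‖p - q‖²`, and the variance is governed by the small `ℓ²` norms
(`variance_pairing_le`). Chebyshev then needs `r L τ` above a constant, that is `r` of order `d L /
ε²`, hence `d² / ε²`. -/

/-! ### Moments of occurrence counts under product distributions -/

section ProductExpectation

set_option linter.unusedSectionVars false

variable {J K Ω : Type} [Fintype J] [DecidableEq J] [Fintype K] [DecidableEq K]
  [Fintype Ω] [DecidableEq Ω]

/-- The expectation of `f` under the product of the weights `P j`. -/
def prodExp (P : J → Ω → ℝ) (f : (J → Ω) → ℝ) : ℝ :=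
  ∑ ω : J → Ω, (∏ j, P j (ω j)) * f ω

theorem prodExp_add (P : J → Ω → ℝ) (f g : (J → Ω) → ℝ) :
    prodExp P (fun ω => f ω + g ω) = prodExp P f + prodExp P g := by
  simp only [prodExp, mul_add, Finset.sum_add_distrib]

theorem prodExp_const_mul (P : J → Ω → ℝ) (c : ℝ) (f : (J → Ω) → ℝ) :
    prodExp P (fun ω => c * f ω) = c * prodExp P f := by
  simp only [prodExp, Finset.mul_sum, mul_left_comm]

theorem prodExp_sum {α : Type} (s : Finset α) (P : J → Ω → ℝ) (f : α → (J → Ω) → ℝ) :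
    prodExp P (fun ω => ∑ a ∈ s, f a ω) = ∑ a ∈ s, prodExp P (f a) := by
  simp only [prodExp, Finset.mul_sum]
  exact Finset.sum_comm

theorem prodExp_prod (P f : J → Ω → ℝ) :
    prodExp P (fun ω => ∏ j, f j (ω j)) = ∏ j, ∑ x, P j x * f j x := by
  simp only [prodExp, ← Finset.prod_mul_distrib]
  rw [Finset.prod_univ_sum]
  simp

theorem prodExp_one {P : J → Ω → ℝ} (hP : ∀ j, ∑ x, P j x = 1) :
    prodExp P (fun _ => 1) = 1 := by
  have := prodExp_prod P (fun _ _ => 1)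
  simpa [hP] using this

theorem prodExp_apply {P : J → Ω → ℝ} (hP : ∀ j, ∑ x, P j x = 1) (k : J) (g : Ω → ℝ) :
    prodExp P (fun ω => g (ω k)) = ∑ x, P k x * g x := by
  have h := prodExp_prod P (fun j x => if j = k then g x else 1)
  have h1 : ∀ ω : J → Ω, (∏ j, if j = k then g (ω j) else 1) = g (ω k) := fun ω => by simp
  simp only [h1] at h
  rw [h, Finset.prod_eq_single k]
  · simp
  · intro j _ hj
    simp [hj, hP]
  · simp

theorem prodExp_apply_mul_apply {P : J → Ω → ℝ} (hP : ∀ j, ∑ x, P j x = 1) {k l : J}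
    (hkl : k ≠ l) (g h : Ω → ℝ) :
    prodExp P (fun ω => g (ω k) * h (ω l)) = (∑ x, P k x * g x) * ∑ x, P l x * h x := by
  have H := prodExp_prod P
    (fun j x => (if j = k then g x else 1) * (if j = l then h x else 1))
  have h1 : ∀ ω : J → Ω, (∏ j, (if j = k then g (ω j) else 1) * (if j = l then h (ω j) else 1))
      = g (ω k) * h (ω l) := fun ω => by
    rw [Finset.prod_mul_distrib]
    simp
  simp only [h1] at H
  rw [H, ← Finset.mul_prod_erase _ _ (Finset.mem_univ k),
    ← Finset.mul_prod_erase _ _ (Finset.mem_erase.2 ⟨hkl.symm, Finset.mem_univ l⟩),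
    Finset.prod_eq_one]
  · simp [hkl, hkl.symm]
  · intro j hj
    simp only [Finset.mem_erase, Finset.mem_univ, and_true] at hj
    simp [hj.1, hj.2, hP]

theorem prodExp_sum_type (P : J ⊕ K → Ω → ℝ) (f : (J → Ω) → ℝ) (g : (K → Ω) → ℝ) :
    prodExp P (fun ω => f (fun j => ω (.inl j)) * g (fun k => ω (.inr k))) =
      prodExp (fun j => P (.inl j)) f * prodExp (fun k => P (.inr k)) g := by
  simp only [prodExp, Finset.sum_mul_sum, ← Fintype.sum_prod_type']
  refine Fintype.sum_equiv (Equiv.sumArrowEquivProdArrow J K Ω) _ _ fun ω => ?_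
  simp only [Fintype.prod_sum_type, Equiv.sumArrowEquivProdArrow, Equiv.coe_fn_mk,
    Function.comp_def]
  ring

theorem prodExp_equiv (e : K ≃ J) (P : J → Ω → ℝ) (f : (K → Ω) → ℝ) :
    prodExp P (fun ω => f (fun k => ω (e k))) = prodExp (fun k => P (e k)) f := by
  refine Fintype.sum_equiv (Equiv.arrowCongr e.symm (Equiv.refl Ω)) _ _ fun ω => ?_
  simp only [Equiv.arrowCongr_apply, Equiv.coe_refl, Function.comp_def, id, Equiv.symm_symm]
  rw [e.prod_comp fun j => P j (ω j)]
  rfl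

/-- Chebyshev's inequality for a finite product of finite distributions. -/
theorem sum_filter_ge_of_chebyshev {P : J → Ω → ℝ} (hP0 : ∀ j x, 0 ≤ P j x)
    (hP : ∀ j, ∑ x, P j x = 1) (T : (J → Ω) → ℝ) {μ t c : ℝ} (ht : 0 < t)
    (hμ : prodExp P T = μ) (hv : prodExp P (fun ω => T ω ^ 2) - μ ^ 2 ≤ c * t ^ 2)
    (good : (J → Ω) → Prop) [DecidablePred good] (hgood : ∀ ω, ¬ good ω → t ≤ |T ω - μ|) :
    1 - c ≤ ∑ ω with good ω, ∏ j, P j (ω j) := by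
  have hw : ∀ ω : J → Ω, 0 ≤ ∏ j, P j (ω j) := fun ω => Finset.prod_nonneg fun j _ => hP0 j _
  have h1 : ∑ ω : J → Ω, ∏ j, P j (ω j) = 1 := by simpa [prodExp] using prodExp_one hP
  rw [← Finset.sum_filter_add_sum_filter_not Finset.univ good] at h1
  have hvar : prodExp P (fun ω => (T ω - μ) ^ 2) = prodExp P (fun ω => T ω ^ 2) - μ ^ 2 := by
    have h2 : (fun ω => (T ω - μ) ^ 2) = fun ω => (T ω ^ 2 + (-2 * μ) * T ω) + μ ^ 2 * 1 := by
      funext ω; ring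
    rw [h2, prodExp_add, prodExp_add, prodExp_const_mul, prodExp_const_mul, hμ, prodExp_one hP]
    ring
  have h3 : t ^ 2 * ∑ ω with ¬ good ω, ∏ j, P j (ω j) ≤ prodExp P (fun ω => (T ω - μ) ^ 2) := by
    rw [Finset.mul_sum]
    refine (Finset.sum_le_sum (g := fun ω => (∏ j, P j (ω j)) * (T ω - μ) ^ 2) ?_).trans
      (Finset.sum_le_univ_sum_of_nonneg fun ω => mul_nonneg (hw ω) (sq_nonneg _))
    intro ω hω
    rw [mul_comm]
    refine mul_le_mul_of_nonneg_left ?_ (hw ω)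
    rw [← sq_abs (T ω - μ)]
    exact pow_le_pow_left₀ ht.le (hgood ω (Finset.mem_filter.1 hω).2) 2
  have h4 : ∑ ω with ¬ good ω, ∏ j, P j (ω j) ≤ c := by
    have : t ^ 2 * ∑ ω with ¬ good ω, ∏ j, P j (ω j) ≤ t ^ 2 * c := by
      rw [mul_comm (t ^ 2) c]; exact h3.trans (hvar ▸ hv)
    exact le_of_mul_le_mul_left this (by positivity)
  linarith

/-- The signed number of occurrences of `x` in the sample `ω`. -/
def signedCount (s : J → ℝ) (ω : J → Ω) (x : Ω) : ℝ :=
  ∑ j, s j * if ω j = x then 1 else 0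

theorem prodExp_signedCount {P : J → Ω → ℝ} (hP : ∀ j, ∑ x, P j x = 1) (s : J → ℝ) (x : Ω) :
    prodExp P (fun ω => signedCount s ω x) = ∑ j, s j * P j x := by
  simp only [signedCount, prodExp_sum, prodExp_const_mul]
  refine Finset.sum_congr rfl fun j _ => ?_
  rw [prodExp_apply hP j (fun y => if y = x then 1 else 0)]
  simp

/-- The covariance matrix of the occurrence counts of a sample. -/
def countCov (P : J → Ω → ℝ) (x y : Ω) : ℝ :=
  (if x = y then ∑ j, P j x else 0) - ∑ j, P j x * P j y

/-- Distinct samples are independent, so only the terms `j = k` deviate from the product of means;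
there the sign enters squared, so the covariance does not depend on `s`. -/
theorem prodExp_signedCount_mul {P : J → Ω → ℝ} (hP : ∀ j, ∑ x, P j x = 1) {s : J → ℝ}
    (hs : ∀ j, s j ^ 2 = 1) (x y : Ω) :
    prodExp P (fun ω => signedCount s ω x * signedCount s ω y) =
      (∑ j, s j * P j x) * (∑ j, s j * P j y) + countCov P x y := by
  have key : ∀ j k, prodExp P (fun ω =>
      (s j * if ω j = x then 1 else 0) * (s k * if ω k = y then 1 else 0)) =
      (s j * P j x) * (s k * P k y) +
        if j = k then (if x = y then P j x else 0) - P j x * P j y else 0 := by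
    intro j k
    have e1 : (fun ω : J → Ω => (s j * if ω j = x then (1 : ℝ) else 0) *
        (s k * if ω k = y then 1 else 0)) = fun ω => (s j * s k) *
          ((if ω j = x then 1 else 0) * (if ω k = y then 1 else 0)) := by
      funext ω; ring
    rw [e1, prodExp_const_mul]
    by_cases hjk : j = k
    · subst hjk
      rw [prodExp_apply hP j
        (fun z => (if z = x then (1 : ℝ) else 0) * (if z = y then 1 else 0)), ← pow_two, hs]
      have e2 : s j * P j x * (s j * P j y) = P j x * P j y := by
        linear_combination (P j x * P j y) * hs j
      rw [e2]
      by_cases hxy : x = y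
      · subst hxy; simp
      · simp [hxy, Ne.symm hxy]
    · rw [prodExp_apply_mul_apply hP hjk (fun z => if z = x then (1 : ℝ) else 0)
        (fun z => if z = y then (1 : ℝ) else 0)]
      simp [hjk]
      ring
  simp only [signedCount, Finset.sum_mul_sum, prodExp_sum, key, Finset.sum_add_distrib,
    countCov]
  congr 1
  simp only [Finset.sum_ite_eq, Finset.mem_univ, if_true, Finset.sum_sub_distrib]
  split_ifs <;> simp

/-- The covariance is a diagonal matrix minus the positive semidefinite `∑ j, P j (P j)ᵀ`, which is
dropped. -/
theorem sum_mul_countCov_le {P : J → Ω → ℝ} (μ : Ω → ℝ) :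
    ∑ x, ∑ y, μ x * μ y * countCov P x y ≤ ∑ x, (∑ j, P j x) * μ x ^ 2 := by
  have h : ∑ x, ∑ y, μ x * μ y * countCov P x y =
      ∑ x, (∑ j, P j x) * μ x ^ 2 - ∑ j, (∑ x, μ x * P j x) ^ 2 := by
    simp only [countCov, mul_sub, Finset.sum_sub_distrib]
    congr 1
    · refine Finset.sum_congr rfl fun x _ => ?_
      simp
      ring
    · simp only [pow_two, Finset.sum_mul_sum]
      simp only [Finset.mul_sum]
      simp only [← Fintype.sum_prod_type']
      refine Fintype.sum_equiv
        ⟨fun a => (a.2.2, a.1, a.2.1), fun a => (a.2.1, a.2.2, a.1),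
          fun _ => rfl, fun _ => rfl⟩ _ _ fun a => ?_
      simp only [Equiv.coe_fn_mk]
      ring
  have h0 : 0 ≤ ∑ j, (∑ x, μ x * P j x) ^ 2 := Finset.sum_nonneg fun j _ => sq_nonneg _
  linarith

/-- Both parts of the covariance are nonnegative, so their cross term is discarded. The second part
has squared Frobenius norm `∑ j k, ⟨P j, P k⟩²`; as `⟨P j, P k⟩ ≤ 1`, this is at most `∑ j k, ⟨P j,
P k⟩`, the squared norm of `∑ j, P j`. -/
theorem sum_countCov_sq_le {P : J → Ω → ℝ} (hP0 : ∀ j x, 0 ≤ P j x)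
    (hP : ∀ j, ∑ x, P j x = 1) :
    ∑ x, ∑ y, countCov P x y ^ 2 ≤ 2 * ∑ x, (∑ j, P j x) ^ 2 := by
  have hR : ∀ x, 0 ≤ ∑ j, P j x := fun x => Finset.sum_nonneg fun j _ => hP0 j x
  have hQ : ∀ x y, 0 ≤ ∑ j, P j x * P j y :=
    fun x y => Finset.sum_nonneg fun j _ => mul_nonneg (hP0 j x) (hP0 j y)
  have h1 : ∀ x y, countCov P x y ^ 2 ≤
      (if x = y then (∑ j, P j x) ^ 2 else 0) + (∑ j, P j x * P j y) ^ 2 := by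
    intro x y
    unfold countCov
    split_ifs
    · nlinarith [mul_nonneg (hR x) (hQ x y)]
    · simp
  have hle : ∀ j k, ∑ x, P j x * P k x ≤ 1 := by
    intro j k
    rw [← hP j]
    refine Finset.sum_le_sum fun x _ => mul_le_of_le_one_right (hP0 j x) ?_
    rw [← hP k]
    exact Finset.single_le_sum (f := P k) (fun y _ => hP0 k y) (Finset.mem_univ x)
  have h2 : ∑ x, ∑ y, (∑ j, P j x * P j y) ^ 2 = ∑ j, ∑ k, (∑ x, P j x * P k x) ^ 2 := by
    simp only [pow_two, Finset.sum_mul_sum]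
    simp only [← Fintype.sum_prod_type']
    refine Fintype.sum_equiv
      ⟨fun a => (a.2.2.1, a.2.2.2, a.1, a.2.1), fun a => (a.2.2.1, a.2.2.2, a.1, a.2.1),
        fun _ => rfl, fun _ => rfl⟩ _ _ fun a => ?_
    simp only [Equiv.coe_fn_mk]
    ring
  have h3 : ∑ j, ∑ k, (∑ x, P j x * P k x) ^ 2 ≤ ∑ j, ∑ k, ∑ x, P j x * P k x := by
    refine Finset.sum_le_sum fun j _ => Finset.sum_le_sum fun k _ => ?_
    have h0 : 0 ≤ ∑ x, P j x * P k x :=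
      Finset.sum_nonneg fun x _ => mul_nonneg (hP0 j x) (hP0 k x)
    nlinarith [hle j k]
  have h4 : ∑ j, ∑ k, ∑ x, P j x * P k x = ∑ x, (∑ j, P j x) ^ 2 := by
    simp only [pow_two, Finset.sum_mul_sum]
    rw [Finset.sum_comm' (t' := Finset.univ) (s' := fun _ => Finset.univ) (by simp)]
    simp only [← Fintype.sum_prod_type']
    refine Fintype.sum_equiv
      ⟨fun a => (a.2.2, a.2.1, a.1), fun a => (a.2.2, a.2.1, a.1),
        fun _ => rfl, fun _ => rfl⟩ _ _ fun a => rfl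
  calc ∑ x, ∑ y, countCov P x y ^ 2
      ≤ ∑ x, ∑ y, ((if x = y then (∑ j, P j x) ^ 2 else 0) + (∑ j, P j x * P j y) ^ 2) :=
        Finset.sum_le_sum fun x _ => Finset.sum_le_sum fun y _ => h1 x y
    _ = ∑ x, (∑ j, P j x) ^ 2 + ∑ x, ∑ y, (∑ j, P j x * P j y) ^ 2 := by
        simp [Finset.sum_add_distrib]
    _ ≤ 2 * ∑ x, (∑ j, P j x) ^ 2 := by linarith

/-- The inner product of the signed counts of the two halves of a sample. -/
def pairing (s : J → ℝ) (ω : J ⊕ J → Ω) : ℝ :=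
  ∑ x, signedCount s (fun j => ω (.inl j)) x * signedCount s (fun j => ω (.inr j)) x

theorem prodExp_pairing {P : J → Ω → ℝ} (hP : ∀ j, ∑ x, P j x = 1) (s : J → ℝ) :
    prodExp (Sum.elim P P) (pairing s) = ∑ x, (∑ j, s j * P j x) ^ 2 := by
  unfold pairing
  rw [prodExp_sum]
  refine Finset.sum_congr rfl fun x _ => ?_
  rw [prodExp_sum_type (Sum.elim P P) (fun η => signedCount s η x) (fun η => signedCount s η x)]
  simp only [Sum.elim_inl, Sum.elim_inr]
  rw [prodExp_signedCount hP, pow_two]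

/-- The halves are independent with the same law, so the second moment is the sum of squares of the
entries of `μ μᵀ + Cov`. Only second moments of counts are needed. -/
theorem variance_pairing_le {P : J → Ω → ℝ} (hP0 : ∀ j x, 0 ≤ P j x)
    (hP : ∀ j, ∑ x, P j x = 1) {s : J → ℝ} (hs : ∀ j, s j ^ 2 = 1) :
    prodExp (Sum.elim P P) (fun ω => pairing s ω ^ 2) - (∑ x, (∑ j, s j * P j x) ^ 2) ^ 2 ≤
      2 * ∑ x, (∑ j, P j x) * (∑ j, s j * P j x) ^ 2 + 2 * ∑ x, (∑ j, P j x) ^ 2 := by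
  set μ : Ω → ℝ := fun x => ∑ j, s j * P j x with hμ
  have h1 : prodExp (Sum.elim P P) (fun ω => pairing s ω ^ 2) =
      ∑ x, ∑ y, (μ x * μ y + countCov P x y) ^ 2 := by
    simp only [pairing, pow_two, Finset.sum_mul_sum, prodExp_sum]
    refine Finset.sum_congr rfl fun x _ => Finset.sum_congr rfl fun y _ => ?_
    have h := prodExp_sum_type (Sum.elim P P) (fun η => signedCount s η x * signedCount s η y)
      (fun η => signedCount s η x * signedCount s η y)
    simp only [Sum.elim_inl, Sum.elim_inr, prodExp_signedCount_mul hP hs] at h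
    rw [← h]
    congr 1
    funext ω
    ring
  have h2 : ∑ x, ∑ y, (μ x * μ y + countCov P x y) ^ 2 = (∑ x, μ x ^ 2) ^ 2 +
      2 * (∑ x, ∑ y, μ x * μ y * countCov P x y) + ∑ x, ∑ y, countCov P x y ^ 2 := by
    rw [pow_two (∑ x, μ x ^ 2), Finset.sum_mul_sum]
    simp only [Finset.mul_sum, ← Finset.sum_add_distrib]
    refine Finset.sum_congr rfl fun x _ => Finset.sum_congr rfl fun y _ => ?_
    ring
  have h3 := sum_mul_countCov_le (P := P) μ
  have h4 := sum_countCov_sq_le hP0 hP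
  rw [h1, h2]
  linarith

end ProductExpectation

/-! ### Tensor products of measurements and their outcome laws -/

section TensorMeasurement

set_option linter.unusedSectionVars false

variable {ι X Ω : Type} [Fintype ι] [Fintype X]

theorem tensorOp_mul [DecidableEq ι] (A B : ι → Matrix X X ℂ) :
    tensorOp A * tensorOp B = tensorOp fun k => A k * B k := by
  ext x y
  simp only [tensorOp, Matrix.mul_apply, Matrix.of_apply, ← Finset.prod_mul_distrib]
  rw [Finset.prod_univ_sum]
  simp

theorem conjTranspose_tensorOp (A : ι → Matrix X X ℂ) :
    (tensorOp A).conjTranspose = tensorOp fun k => (A k).conjTranspose := by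
  ext x y
  simp [tensorOp, Matrix.conjTranspose_apply]

theorem trace_tensorOp [DecidableEq ι] (A : ι → Matrix X X ℂ) :
    (tensorOp A).trace = ∏ k, (A k).trace := by
  simp only [tensorOp, Matrix.trace, Matrix.diag, Matrix.of_apply]
  rw [Finset.prod_univ_sum]
  simp

theorem Matrix.PosSemidef.exists_eq_conjTranspose_mul_self [DecidableEq X] {A : Matrix X X ℂ}
    (hA : A.PosSemidef) : ∃ B : Matrix X X ℂ, A = B.conjTranspose * B :=
  CStarAlgebra.nonneg_iff_eq_star_mul_self.1 (Matrix.nonneg_iff_posSemidef.2 hA)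

theorem posSemidef_tensorOp [DecidableEq ι] [DecidableEq X] {A : ι → Matrix X X ℂ}
    (hA : ∀ k, (A k).PosSemidef) : (tensorOp A).PosSemidef := by
  choose B hB using fun k => (hA k).exists_eq_conjTranspose_mul_self
  have : tensorOp A = (tensorOp B).conjTranspose * tensorOp B := by
    rw [conjTranspose_tensorOp, tensorOp_mul]
    exact congrArg tensorOp (funext hB)
  rw [this]
  exact Matrix.posSemidef_conjTranspose_mul_self _

theorem Matrix.PosSemidef.trace_mul_nonneg [DecidableEq X] {A B : Matrix X X ℂ}
    (hA : A.PosSemidef) (hB : B.PosSemidef) : 0 ≤ (A * B).trace := by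
  obtain ⟨C, rfl⟩ := hA.exists_eq_conjTranspose_mul_self
  rw [Matrix.mul_assoc, Matrix.trace_mul_comm]
  exact (hB.mul_mul_conjTranspose_same C).trace_nonneg

namespace POVM

variable [DecidableEq X] [Fintype Ω]

/-- The tensor product of measurements on individual systems. -/
def tensor [DecidableEq ι] (N : ι → POVM X Ω) : POVM (ι → X) (ι → Ω) where
  effect ω := tensorOp fun k => (N k).effect (ω k)
  posSemidef ω := posSemidef_tensorOp fun k => (N k).posSemidef (ω k)
  sum_effect := by
    ext x y
    simp only [Matrix.sum_apply, tensorOp, Matrix.of_apply]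
    have h := Finset.prod_univ_sum (fun _ : ι => (Finset.univ : Finset Ω))
      (fun k w => (N k).effect w (x k) (y k))
    rw [Fintype.piFinset_univ] at h
    rw [← h]
    simp only [← Matrix.sum_apply, (N _).sum_effect, Matrix.one_apply]
    by_cases hxy : x = y
    · simp [hxy]
    · obtain ⟨k, hk⟩ := Function.ne_iff.1 hxy
      rw [if_neg hxy]
      exact Finset.prod_eq_zero (Finset.mem_univ k) (if_neg hk)

theorem isIndependent_tensor [DecidableEq ι] (N : ι → POVM X Ω) : (tensor N).IsIndependent :=
  ⟨N, fun _ => rfl⟩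

theorem prob_nonneg (M : POVM X Ω) {ρ : Matrix X X ℂ} (hρ : ρ.PosSemidef) (ω : Ω) :
    0 ≤ M.prob ρ ω :=
  (Complex.nonneg_iff.1 ((M.posSemidef ω).trace_mul_nonneg hρ)).1

theorem ofReal_prob (M : POVM X Ω) {ρ : Matrix X X ℂ} (hρ : ρ.PosSemidef) (ω : Ω) :
    (M.prob ρ ω : ℂ) = (M.effect ω * ρ).trace :=
  Complex.ext rfl (Complex.nonneg_iff.1 ((M.posSemidef ω).trace_mul_nonneg hρ)).2

theorem sum_prob (M : POVM X Ω) {ρ : Matrix X X ℂ} (hρ : ρ.trace = 1) :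
    ∑ ω, M.prob ρ ω = 1 := by
  simp only [prob, ← Complex.re_sum, ← Matrix.trace_sum, ← Finset.sum_mul, M.sum_effect]
  simp [hρ]

theorem prob_tensor [DecidableEq ι] (N : ι → POVM X Ω) {τ : ι → Matrix X X ℂ}
    (hτ : ∀ k, (τ k).PosSemidef) (ω : ι → Ω) :
    (tensor N).prob (tensorOp τ) ω = ∏ k, (N k).prob (τ k) (ω k) := by
  have h : ((tensor N).effect ω * tensorOp τ).trace =
      ((∏ k, (N k).prob (τ k) (ω k) : ℝ) : ℂ) := by
    simp only [tensor, tensorOp_mul, trace_tensorOp, Complex.ofReal_prod, ofReal_prob _ (hτ _)]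
  rw [prob, h, Complex.ofReal_re]

/-- Renaming the outcomes of a measurement. -/
def relabel {Ω' : Type} [Fintype Ω'] (M : POVM X Ω) (e : Ω' ≃ Ω) : POVM X Ω' where
  effect ω := M.effect (e ω)
  posSemidef ω := M.posSemidef (e ω)
  sum_effect := by rw [e.sum_comp M.effect, M.sum_effect]

end POVM

end TensorMeasurement

/-! ### Trace norm against Hilbert–Schmidt norm -/

section TraceNorm

variable {X : Type} [Fintype X]

theorem re_trace_conjTranspose_mul_self (A : Matrix X X ℂ) :
    (A.conjTranspose * A).trace.re = ∑ x, ∑ y, ‖A y x‖ ^ 2 := by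
  simp only [Matrix.trace, Matrix.diag, Matrix.mul_apply, Matrix.conjTranspose_apply,
    Complex.re_sum]
  refine Finset.sum_congr rfl fun x _ => Finset.sum_congr rfl fun y _ => ?_
  rw [← Complex.normSq_eq_norm_sq, Complex.normSq_apply]
  simp

/-- Cauchy–Schwarz on the diagonal of `|A|`, whose Hilbert–Schmidt norm is that of `A` because `|A|²
= A† A`. -/
theorem traceNorm_sq_le [DecidableEq X] (A : Matrix X X ℂ) :
    traceNorm A ^ 2 ≤ Fintype.card X * (A.conjTranspose * A).trace.re := by
  set B := CFC.abs A with hB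
  have hBh : B.conjTranspose = B := (Matrix.nonneg_iff_posSemidef.1 (CFC.abs_nonneg A)).1
  have hBB : B.conjTranspose * B = A.conjTranspose * A := by
    rw [hBh]
    exact CFC.abs_mul_abs A
  rw [← hBB, re_trace_conjTranspose_mul_self, traceNorm, ← hB, Matrix.trace, Complex.re_sum]
  refine sq_sum_le_card_mul_sum_sq.trans ?_
  rw [Finset.card_univ]
  refine mul_le_mul_of_nonneg_left (Finset.sum_le_sum fun x _ => ?_) (Nat.cast_nonneg _)
  refine le_trans ?_ (Finset.single_le_sum (f := fun y => ‖B y x‖ ^ 2)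
    (fun y _ => by positivity) (Finset.mem_univ x))
  rw [← sq_abs]
  exact pow_le_pow_left₀ (abs_nonneg _) (Complex.abs_re_le_norm _) 2

theorem Matrix.PosSemidef.re_trace_mul_self_le {A : Matrix X X ℂ} (hA : A.PosSemidef) :
    (A * A).trace.re ≤ A.trace.re ^ 2 := by
  have hdiag : ∀ x, (A x x).im = 0 := fun x =>
    (Complex.nonneg_iff.1 (hA.diag_nonneg (i := x))).2.symm
  simp only [Matrix.trace, Matrix.diag, Matrix.mul_apply, Complex.re_sum, pow_two,
    Finset.sum_mul_sum]
  refine Finset.sum_le_sum fun x _ => Finset.sum_le_sum fun y _ => ?_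
  -- Nonnegative 2 × 2 minors give `|A x y|² ≤ A x x * A y y`, to be summed over `x, y`.
  have h := (hA.submatrix ![x, y]).det_nonneg
  rw [Matrix.det_fin_two] at h
  have h1 := (Complex.nonneg_iff.1 h).1
  simp [hdiag] at h1
  simpa using h1

theorem re_trace_sub_mul_self_le [DecidableEq X] {ρ σ : Matrix X X ℂ}
    (hρ : ρ ∈ densityOperators X) (hσ : σ ∈ densityOperators X) :
    ((ρ - σ) * (ρ - σ)).trace.re ≤ 2 := by
  have h1 := hρ.1.re_trace_mul_self_le
  have h2 := hσ.1.re_trace_mul_self_le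
  have h3 := (Complex.nonneg_iff.1 (hρ.1.trace_mul_nonneg hσ.1)).1
  rw [hρ.2] at h1
  rw [hσ.2] at h2
  have h4 : ((ρ - σ) * (ρ - σ)).trace =
      (ρ * ρ).trace + (σ * σ).trace - (ρ * σ).trace - (ρ * σ).trace := by
    rw [Matrix.sub_mul, Matrix.mul_sub, Matrix.mul_sub, Matrix.trace_sub, Matrix.trace_sub,
      Matrix.trace_sub, Matrix.trace_mul_comm σ ρ]
    ring
  rw [h4]
  simp at h1 h2 ⊢
  linarith

theorem traceNorm_sub_sq_le [DecidableEq X] {ρ σ : Matrix X X ℂ}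
    (hρ : ρ ∈ densityOperators X) (hσ : σ ∈ densityOperators X) :
    traceNorm (ρ - σ) ^ 2 ≤ Fintype.card X * ((ρ - σ) * (ρ - σ)).trace.re := by
  have h := traceNorm_sq_le (ρ - σ)
  rwa [Matrix.conjTranspose_sub, hρ.1.1, hσ.1.1] at h

end TraceNorm

/-! ### A 2-design from mutually unbiased bases -/

section Design

set_option linter.unusedSectionVars false

variable {p : ℕ} [Fact p.Prime] {X : Type} [Fintype X]

open ZMod in
theorem sum_stdAddChar_mul_add (u v : ZMod p) :
    ∑ c : ZMod p × ZMod p, (stdAddChar (c.1 * u + c.2 * v) : ℂ) =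
      if u = 0 ∧ v = 0 then (p : ℂ) ^ 2 else 0 := by
  have hp := isPrimitive_stdAddChar p
  simp only [AddChar.map_add_eq_mul, Fintype.sum_prod_type, ← Finset.sum_mul_sum,
    AddChar.sum_mulShift _ hp, ZMod.card]
  by_cases hu : u = 0 <;> by_cases hv : v = 0 <;> simp [hu, hv, pow_two]

/-- The vectors of the quadratic-phase bases: `x ↦ χ(a x² + b x)`. -/
noncomputable def quadraticPhase (f : X → ZMod p) (c : ZMod p × ZMod p) (x : X) : ℂ :=
  ZMod.stdAddChar (c.1 * f x ^ 2 + c.2 * f x)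

theorem quadraticPhase_mul_star (f : X → ZMod p) (c : ZMod p × ZMod p) (x y : X) :
    quadraticPhase f c x * star (quadraticPhase f c y) =
      ZMod.stdAddChar (c.1 * (f x ^ 2 - f y ^ 2) + c.2 * (f x - f y)) := by
  have h : star (quadraticPhase f c y) = ZMod.stdAddChar (-(c.1 * f y ^ 2 + c.2 * f y)) := by
    rw [AddChar.map_neg_eq_conj]
    rfl
  rw [h, quadraticPhase, ← AddChar.map_add_eq_mul]
  congr 1
  ring

theorem sum_quadraticPhase [DecidableEq X] {f : X → ZMod p} (hf : f.Injective) (x y : X) :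
    ∑ c, quadraticPhase f c x * star (quadraticPhase f c y) =
      if x = y then (p : ℂ) ^ 2 else 0 := by
  simp only [quadraticPhase_mul_star, sum_stdAddChar_mul_add]
  refine if_congr ⟨fun h => hf (sub_eq_zero.1 h.2), ?_⟩ rfl rfl
  rintro rfl
  simp

/-- Away from characteristic 2, the sum and the sum of squares determine an unordered pair. -/
theorem add_eq_add_and_sq_add_sq_eq {F : Type} [Field F] (h2 : (2 : F) ≠ 0) {x y z w : F}
    (h1 : x ^ 2 - y ^ 2 + (z ^ 2 - w ^ 2) = 0) (h0 : x - y + (z - w) = 0) :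
    (x = y ∧ z = w) ∨ (x = w ∧ z = y) := by
  have h : 2 * ((x - y) * (x - w)) = 0 := by
    have hz : z = y + w - x := by linear_combination h0
    subst hz
    linear_combination h1
  rcases mul_eq_zero.1 ((mul_eq_zero.1 h).resolve_left h2) with h | h
  · exact .inl ⟨sub_eq_zero.1 h, by linear_combination h0 - h⟩
  · exact .inr ⟨sub_eq_zero.1 h, by linear_combination h0 - h⟩

/-- Orthogonality of characters keeps the quadruples with `{x, z} = {y, w}`; the last term corrects
the double count when all four agree. -/
theorem sum_quadraticPhase_two [DecidableEq X] (hp : p ≠ 2) {f : X → ZMod p}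
    (hf : f.Injective) (x y z w : X) :
    ∑ c, (quadraticPhase f c x * star (quadraticPhase f c y)) *
        (quadraticPhase f c z * star (quadraticPhase f c w)) =
      (p : ℂ) ^ 2 * ((if x = y ∧ z = w then 1 else 0) + (if x = w ∧ z = y then 1 else 0) -
        if x = y ∧ z = w ∧ x = z then 1 else 0) := by
  have h2 : (2 : ZMod p) ≠ 0 := by
    exact_mod_cast ZMod.prime_ne_zero p 2 hp
  have h : ∀ c : ZMod p × ZMod p, (quadraticPhase f c x * star (quadraticPhase f c y)) *
      (quadraticPhase f c z * star (quadraticPhase f c w)) =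
      ZMod.stdAddChar (c.1 * (f x ^ 2 - f y ^ 2 + (f z ^ 2 - f w ^ 2)) +
        c.2 * (f x - f y + (f z - f w))) := by
    intro c
    rw [quadraticPhase_mul_star, quadraticPhase_mul_star, ← AddChar.map_add_eq_mul]
    congr 1
    ring
  simp only [h, sum_stdAddChar_mul_add]
  have hiff : (f x ^ 2 - f y ^ 2 + (f z ^ 2 - f w ^ 2) = 0 ∧ f x - f y + (f z - f w) = 0) ↔
      (x = y ∧ z = w) ∨ (x = w ∧ z = y) := by
    constructor
    · rintro ⟨h1, h0⟩
      exact (add_eq_add_and_sq_add_sq_eq h2 h1 h0).imp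
        (fun h => ⟨hf h.1, hf h.2⟩) (fun h => ⟨hf h.1, hf h.2⟩)
    · rintro (⟨rfl, rfl⟩ | ⟨rfl, rfl⟩) <;> constructor <;> ring
  rw [if_congr hiff rfl rfl]
  by_cases h1 : x = y ∧ z = w <;> by_cases h3 : x = w ∧ z = y
  · obtain ⟨rfl, rfl⟩ := h1
    simp [h3.1]
  · obtain ⟨rfl, rfl⟩ := h1
    have : x ≠ z := fun h => h3 ⟨h, h.symm⟩
    simp [this]
  · have h4 : ¬ (x = y ∧ z = w ∧ x = z) := fun h => h1 ⟨h.1, h.2.1⟩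
    rw [if_pos (.inr h3), if_neg h1, if_pos h3, if_neg h4]
    ring
  · have h4 : ¬ (x = y ∧ z = w ∧ x = z) := fun h => h1 ⟨h.1, h.2.1⟩
    simp only [h1, h3, h4]
    simp

/-- The measurement in `p + 1` mutually unbiased bases of `ℂ^p`, chosen uniformly at random,
compressed to `ℂ^X` along an injection `f : X → ZMod p`. -/
noncomputable def unbiasedPOVM [DecidableEq X] {f : X → ZMod p} (hf : f.Injective) :
    POVM X ((ZMod p × ZMod p) ⊕ X) where
  effect := Sum.elim
    (fun c => ((p : ℝ) * (p + 1))⁻¹ •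
      Matrix.vecMulVec (quadraticPhase f c) (star (quadraticPhase f c)))
    (fun u => ((p : ℝ) + 1)⁻¹ • Matrix.vecMulVec (Pi.single u 1) (star (Pi.single u 1)))
  posSemidef := by
    rintro (c | u)
    · exact (Matrix.posSemidef_vecMulVec_self_star _).smul (by positivity)
    · exact (Matrix.posSemidef_vecMulVec_self_star _).smul (by positivity)
  sum_effect := by
    have hp0 : (p : ℂ) ≠ 0 := Nat.cast_ne_zero.2 (Fact.out : p.Prime).ne_zero
    have hp1 : (p : ℂ) + 1 ≠ 0 := Nat.cast_add_one_ne_zero p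
    ext x y
    simp only [Fintype.sum_sum_type, Sum.elim_inl, Sum.elim_inr, ← Finset.smul_sum,
      Matrix.smul_apply, Matrix.sum_apply, Matrix.vecMulVec_apply,
      Pi.star_apply, sum_quadraticPhase hf]
    have h : ∑ u : X, (Pi.single u (1 : ℂ) : X → ℂ) x * star ((Pi.single u (1 : ℂ) : X → ℂ) y) =
        if x = y then 1 else 0 := by
      simp [Pi.single_apply]
    rw [h, Matrix.one_apply]
    split_ifs
    · simp only [Complex.real_smul]
      push_cast
      field_simp
    · simp

theorem trace_vecMulVec_mul (v w : X → ℂ) (A : Matrix X X ℂ) :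
    (Matrix.vecMulVec v w * A).trace = ∑ x, ∑ y, v x * w y * A y x := by
  simp [Matrix.trace, Matrix.mul_apply, Matrix.vecMulVec_apply]

theorem sum_trace_quadraticPhase_sq [DecidableEq X] (hp : p ≠ 2) {f : X → ZMod p}
    (hf : f.Injective) (A : Matrix X X ℂ) :
    ∑ c, (Matrix.vecMulVec (quadraticPhase f c) (star (quadraticPhase f c)) * A).trace ^ 2 =
      (p : ℂ) ^ 2 * (A.trace ^ 2 + (A * A).trace - ∑ x, A x x ^ 2) := by
  have h : ∀ c, (Matrix.vecMulVec (quadraticPhase f c) (star (quadraticPhase f c)) * A).trace ^ 2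
      = ∑ x, ∑ y, ∑ z, ∑ w, ((quadraticPhase f c x * star (quadraticPhase f c y)) *
        (quadraticPhase f c z * star (quadraticPhase f c w))) * (A y x * A w z) := by
    intro c
    rw [trace_vecMulVec_mul, pow_two, Finset.sum_mul]
    refine Finset.sum_congr rfl fun x _ => ?_
    rw [Finset.sum_mul]
    refine Finset.sum_congr rfl fun y _ => ?_
    simp only [Finset.mul_sum]
    refine Finset.sum_congr rfl fun z _ => Finset.sum_congr rfl fun w _ => ?_
    simp only [Pi.star_apply]
    ring
  simp only [h]
  rw [Finset.sum_comm]
  have h' : ∀ x, ∑ c, ∑ y, ∑ z, ∑ w, ((quadraticPhase f c x * star (quadraticPhase f c y)) *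
        (quadraticPhase f c z * star (quadraticPhase f c w))) * (A y x * A w z) =
      (p : ℂ) ^ 2 * (A x x * A.trace + (A * A) x x - A x x ^ 2) := by
    intro x
    rw [Finset.sum_comm]
    have h1 : ∀ y, ∑ c, ∑ z, ∑ w, ((quadraticPhase f c x * star (quadraticPhase f c y)) *
        (quadraticPhase f c z * star (quadraticPhase f c w))) * (A y x * A w z) =
        ∑ z, ∑ w, (p : ℂ) ^ 2 * ((if x = y ∧ z = w then 1 else 0) +
          (if x = w ∧ z = y then 1 else 0) -
          if x = y ∧ z = w ∧ x = z then 1 else 0) * (A y x * A w z) := by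
      intro y
      rw [Finset.sum_comm]
      refine Finset.sum_congr rfl fun z _ => ?_
      rw [Finset.sum_comm]
      refine Finset.sum_congr rfl fun w _ => ?_
      rw [← Finset.sum_mul, sum_quadraticPhase_two hp hf]
    rw [Finset.sum_congr rfl fun y _ => h1 y]
    simp only [mul_assoc, ← Finset.mul_sum, sub_mul, add_mul, Finset.sum_add_distrib,
      Finset.sum_sub_distrib, ite_and, ite_mul, one_mul, zero_mul, Matrix.trace, Matrix.diag,
      Matrix.mul_apply]
    simp
    simp [Finset.mul_sum, mul_comm, pow_two]
  simp only [h', ← Finset.mul_sum, Finset.sum_add_distrib, Finset.sum_sub_distrib,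
    ← Finset.sum_mul]
  simp [Matrix.trace, pow_two]

/-- The standard basis supplies exactly the `∑ x, A x x ^ 2` missing from the quadratic-phase bases.
-/
theorem sum_trace_unbiasedPOVM_sq [DecidableEq X] (hp : p ≠ 2) {f : X → ZMod p}
    (hf : f.Injective) (A : Matrix X X ℂ) :
    ∑ ω, ((unbiasedPOVM hf).effect ω * A).trace ^ 2 =
      (A.trace ^ 2 + (A * A).trace) / ((p : ℂ) + 1) ^ 2 := by
  have hp0 : (p : ℂ) ≠ 0 := Nat.cast_ne_zero.2 (Fact.out : p.Prime).ne_zero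
  have hp1 : (p : ℂ) + 1 ≠ 0 := Nat.cast_add_one_ne_zero p
  have h : ∀ u : X, (Matrix.vecMulVec (Pi.single u (1 : ℂ)) (star (Pi.single u 1)) * A).trace =
      A u u := by
    intro u
    rw [trace_vecMulVec_mul]
    simp [Pi.single_apply]
  simp only [unbiasedPOVM, Fintype.sum_sum_type, Sum.elim_inl, Sum.elim_inr, Matrix.smul_mul,
    Matrix.trace_smul, Complex.real_smul, mul_pow, ← Finset.mul_sum, h,
    sum_trace_quadraticPhase_sq hp hf]
  push_cast
  field_simp
  ring

end Design

/-! ### Classical `ℓ²` closeness testing -/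

section ClosenessTesting

set_option linter.unusedSectionVars false

variable {Ω : Type} [Fintype Ω] [DecidableEq Ω]

/-- The indices of `2 r` samples from each of two sources, divided into two halves. -/
def halvesEquiv (r : ℕ) :
    (Fin r ⊕ Fin r) ⊕ (Fin r ⊕ Fin r) ≃ Fin (r + r) ⊕ Fin (r + r) :=
  (Equiv.sumSumSumComm _ _ _ _).trans (Equiv.sumCongr finSumFinEquiv finSumFinEquiv)

/-- The `ℓ²` closeness statistic of a sample from two sources. -/
def closenessStat (r : ℕ) (ω : Fin (r + r) ⊕ Fin (r + r) → Ω) : ℝ :=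
  pairing (Sum.elim (fun _ => 1) (fun _ => -1)) fun k => ω (halvesEquiv r k)

theorem sum_elim_halvesEquiv {α : Type} (r : ℕ) (p q : α) :
    (fun k => (Sum.elim (fun _ => p) (fun _ => q) : Fin (r + r) ⊕ Fin (r + r) → α)
      (halvesEquiv r k)) =
    Sum.elim (Sum.elim (fun _ => p) (fun _ => q)) (Sum.elim (fun _ => p) (fun _ => q)) := by
  funext k
  rcases k with (k | k) | (k | k) <;> rfl

theorem prodExp_closenessStat {p q : Ω → ℝ} (hp : ∑ x, p x = 1) (hq : ∑ x, q x = 1) (r : ℕ) :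
    prodExp (Sum.elim (fun _ => p) (fun _ => q)) (closenessStat r) =
      (r : ℝ) ^ 2 * ∑ x, (p x - q x) ^ 2 := by
  unfold closenessStat
  rw [prodExp_equiv (halvesEquiv r) _ (pairing _), sum_elim_halvesEquiv, prodExp_pairing]
  · rw [Finset.mul_sum]
    refine Finset.sum_congr rfl fun x _ => ?_
    simp
    ring
  · rintro (j | j) <;> assumption

/-- An entry is at most the `ℓ²` norm; `3 / 2` is a rational bound for `√2`. -/
theorem le_of_sum_sq_le {p : Ω → ℝ} {L : ℝ} (hL : 0 < L)
    (h : ∑ x, p x ^ 2 ≤ 2 / L ^ 2) (x : Ω) : p x ≤ (3 / 2) / L := by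
  have h1 : p x ^ 2 ≤ 2 / L ^ 2 :=
    (Finset.single_le_sum (f := fun y => p y ^ 2) (fun y _ => sq_nonneg _)
      (Finset.mem_univ x)).trans h
  refine le_of_sq_le_sq (h1.trans ?_) (by positivity)
  rw [div_pow]
  gcongr
  norm_num

theorem variance_closenessStat_le {p q : Ω → ℝ} (hp0 : ∀ x, 0 ≤ p x) (hq0 : ∀ x, 0 ≤ q x)
    (hp : ∑ x, p x = 1) (hq : ∑ x, q x = 1) {L : ℝ} (hL : 0 < L)
    (hpL : ∑ x, p x ^ 2 ≤ 2 / L ^ 2) (hqL : ∑ x, q x ^ 2 ≤ 2 / L ^ 2) (r : ℕ) :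
    prodExp (Sum.elim (fun _ => p) (fun _ => q)) (fun ω => closenessStat r ω ^ 2) -
      ((r : ℝ) ^ 2 * ∑ x, (p x - q x) ^ 2) ^ 2 ≤
      6 * r ^ 3 * (∑ x, (p x - q x) ^ 2) / L + 16 * r ^ 2 / L ^ 2 := by
  set P : Fin r ⊕ Fin r → Ω → ℝ := Sum.elim (fun _ => p) (fun _ => q) with hPdef
  set s : Fin r ⊕ Fin r → ℝ := Sum.elim (fun _ => 1) (fun _ => -1) with hsdef
  have hv := variance_pairing_le (P := P) (s := s) (by rintro (j | j) <;> assumption)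
    (by rintro (j | j) <;> assumption) (by rintro (j | j) <;> simp [hsdef])
  have hμ : ∀ x, ∑ j, s j * P j x = r * (p x - q x) := fun x => by
    simp [hsdef, hPdef]
    ring
  have hR : ∀ x, ∑ j, P j x = r * (p x + q x) := fun x => by
    simp [hPdef]
    ring
  simp only [hμ, hR] at hv
  unfold closenessStat
  rw [prodExp_equiv (halvesEquiv r) _ (fun η => pairing s η ^ 2), sum_elim_halvesEquiv]
  have e1 : ∑ x, ((r : ℝ) * (p x - q x)) ^ 2 = (r : ℝ) ^ 2 * ∑ x, (p x - q x) ^ 2 := by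
    simp only [mul_pow, Finset.mul_sum]
  have e2 : ∑ x, (r : ℝ) * (p x + q x) * (r * (p x - q x)) ^ 2 ≤
      3 * r ^ 3 * (∑ x, (p x - q x) ^ 2) / L := by
    rw [Finset.mul_sum, Finset.sum_div]
    refine Finset.sum_le_sum fun x _ => ?_
    have h1 : p x + q x ≤ 3 / L := by
      have h2 := le_of_sum_sq_le hL hpL x
      have h3 := le_of_sum_sq_le hL hqL x
      have h4 : 3 / L = (3 / 2) / L + (3 / 2) / L := by ring
      linarith
    calc (r : ℝ) * (p x + q x) * (r * (p x - q x)) ^ 2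
        = (p x + q x) * (r ^ 3 * (p x - q x) ^ 2) := by ring
      _ ≤ 3 / L * (r ^ 3 * (p x - q x) ^ 2) := by gcongr
      _ = 3 * r ^ 3 * (p x - q x) ^ 2 / L := by ring
  have e3 : ∑ x, ((r : ℝ) * (p x + q x)) ^ 2 ≤ 8 * r ^ 2 / L ^ 2 := by
    calc ∑ x, ((r : ℝ) * (p x + q x)) ^ 2
        ≤ ∑ x, (r : ℝ) ^ 2 * (2 * (p x ^ 2 + q x ^ 2)) := by
          refine Finset.sum_le_sum fun x _ => ?_
          rw [mul_pow]
          gcongr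
          nlinarith [sq_nonneg (p x - q x)]
      _ = (r : ℝ) ^ 2 * (2 * (∑ x, p x ^ 2 + ∑ x, q x ^ 2)) := by
          rw [← Finset.sum_add_distrib, Finset.mul_sum, Finset.mul_sum]
      _ ≤ (r : ℝ) ^ 2 * (2 * (2 / L ^ 2 + 2 / L ^ 2)) := by gcongr
      _ = 8 * r ^ 2 / L ^ 2 := by ring
  rw [e1] at hv
  refine hv.trans ?_
  have e4 : 6 * (r : ℝ) ^ 3 * (∑ x, (p x - q x) ^ 2) / L + 16 * r ^ 2 / L ^ 2 =
      2 * (3 * r ^ 3 * (∑ x, (p x - q x) ^ 2) / L) + 2 * (8 * r ^ 2 / L ^ 2) := by ring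
  linarith

theorem closenessTest_of_eq {p : Ω → ℝ} (hp0 : ∀ x, 0 ≤ p x) (hp : ∑ x, p x = 1)
    {L τ : ℝ} (hL : 0 < L) (hτ : 0 < τ) (hpL : ∑ x, p x ^ 2 ≤ 2 / L ^ 2) {r : ℕ}
    (hr : 80 ≤ r * L * τ) :
    2 / 3 ≤ ∑ ω : Fin (r + r) ⊕ Fin (r + r) → Ω with closenessStat r ω < r ^ 2 * τ / 2,
      ∏ k, (Sum.elim (fun _ => p) (fun _ => p) : _ → Ω → ℝ) k (ω k) := by
  have hr0 : (0 : ℝ) < r := by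
    rcases Nat.eq_zero_or_pos r with rfl | h
    · norm_num at hr
    · exact_mod_cast h
  have hμ := prodExp_closenessStat hp hp r
  have hv := variance_closenessStat_le hp0 hp0 hp hp hL hpL hpL r
  simp only [sub_self, ne_eq, OfNat.ofNat_ne_zero, not_false_eq_true, zero_pow,
    Finset.sum_const_zero, mul_zero, zero_div, zero_add] at hμ hv
  have h := sum_filter_ge_of_chebyshev (t := r ^ 2 * τ / 2) (c := 1 / 3) (μ := 0)
    (P := Sum.elim (fun _ => p) (fun _ => p))
    (by rintro (j | j) <;> assumption) (by rintro (j | j) <;> assumption)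
    (closenessStat r) (by positivity) hμ ?_ (fun ω => closenessStat r ω < r ^ 2 * τ / 2) ?_
  · linarith
  · simp only [ne_eq, OfNat.ofNat_ne_zero, not_false_eq_true, zero_pow]
    refine hv.trans ?_
    rw [div_le_iff₀ (by positivity)]
    -- With mean zero, Chebyshev only asks for `(r L τ)² ≥ 192`.
    have h1 : 80 ^ 2 ≤ (r * L * τ) ^ 2 := pow_le_pow_left₀ (by norm_num) hr 2
    have h2 : 1 / 3 * ((r : ℝ) ^ 2 * τ / 2) ^ 2 * L ^ 2 = r ^ 2 * ((r * L * τ) ^ 2 / 12) := by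
      ring
    rw [h2, mul_comm (16 : ℝ)]
    gcongr
    linarith
  · intro ω hω
    rw [sub_zero]
    exact (not_lt.1 hω).trans (le_abs_self _)

theorem closenessTest_of_le {p q : Ω → ℝ} (hp0 : ∀ x, 0 ≤ p x) (hq0 : ∀ x, 0 ≤ q x)
    (hp : ∑ x, p x = 1) (hq : ∑ x, q x = 1) {L τ : ℝ} (hL : 0 < L) (hτ : 0 < τ)
    (hpL : ∑ x, p x ^ 2 ≤ 2 / L ^ 2) (hqL : ∑ x, q x ^ 2 ≤ 2 / L ^ 2) {r : ℕ}
    (hr : 80 ≤ r * L * τ) (hfar : τ ≤ ∑ x, (p x - q x) ^ 2) :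
    2 / 3 ≤ ∑ ω : Fin (r + r) ⊕ Fin (r + r) → Ω with ¬ closenessStat r ω < r ^ 2 * τ / 2,
      ∏ k, (Sum.elim (fun _ => p) (fun _ => q) : _ → Ω → ℝ) k (ω k) := by
  have hr0 : (0 : ℝ) < r := by
    rcases Nat.eq_zero_or_pos r with rfl | h
    · norm_num at hr
    · exact_mod_cast h
  have hμ := prodExp_closenessStat hp hq r
  have hv := variance_closenessStat_le hp0 hq0 hp hq hL hpL hqL r
  set D : ℝ := ∑ x, (p x - q x) ^ 2 with hD
  have hD0 : 0 < D := hτ.trans_le hfar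
  have h := sum_filter_ge_of_chebyshev (t := r ^ 2 * D / 2) (c := 1 / 3)
    (P := Sum.elim (fun _ => p) (fun _ => q))
    (by rintro (j | j) <;> assumption) (by rintro (j | j) <;> assumption)
    (closenessStat r) (by positivity) hμ ?_ (fun ω => ¬ closenessStat r ω < r ^ 2 * τ / 2) ?_
  · linarith
  · refine hv.trans ?_
    -- The deviation allowed is half the mean. For `v = r L D`, Chebyshev requires `6 v + 16 ≤ v² /
    -- 12`, which is what the constant 80 ensures.
    have hu : 80 ≤ r * L * D := hr.trans (by gcongr)
    have h1 : 6 * (r : ℝ) ^ 3 * D / L + 16 * r ^ 2 / L ^ 2 =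
        r ^ 2 * (6 * (r * L * D) + 16) / L ^ 2 := by
      field_simp
    have h2 : 1 / 3 * ((r : ℝ) ^ 2 * D / 2) ^ 2 * L ^ 2 = r ^ 2 * ((r * L * D) ^ 2 / 12) := by
      ring
    rw [h1, div_le_iff₀ (by positivity), h2]
    gcongr
    nlinarith
  · intro ω hω
    rw [not_not] at hω
    have h1 : (r : ℝ) ^ 2 * τ / 2 ≤ r ^ 2 * D / 2 := by gcongr
    rw [abs_sub_comm]
    refine le_trans ?_ (le_abs_self _)
    linarith

end ClosenessTesting

/-! ### From the design to the quantum tester -/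

theorem exists_informationallyComplete_povm {d : ℕ} (hd : 0 < d) :
    ∃ (L : ℝ) (m : ℕ) (N : POVM (Fin d) (Fin m)), 0 < L ∧ L ≤ 5 * d ∧
      ∀ A : Matrix (Fin d) (Fin d) ℂ,
        ∑ ω, (N.effect ω * A).trace ^ 2 = (A.trace ^ 2 + (A * A).trace) / (L : ℂ) ^ 2 := by
  -- Bertrand's postulate at `d + 1` rather than `d` forces `p ≠ 2`, and `p + 1 ≤ 2 d + 3 ≤ 5 d`.
  obtain ⟨p, hp, hdp, hpd⟩ := Nat.exists_prime_lt_and_le_two_mul (d + 1) (by omega)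
  have := Fact.mk hp
  have hf : (fun x : Fin d => ((x : ℕ) : ZMod p)).Injective := by
    intro x y hxy
    have h := (ZMod.natCast_eq_natCast_iff' _ _ _).1 hxy
    rw [Nat.mod_eq_of_lt (by omega), Nat.mod_eq_of_lt (by omega)] at h
    exact Fin.ext h
  refine ⟨p + 1, _, (unbiasedPOVM hf).relabel (Fintype.equivFin _).symm, by positivity, ?_,
    fun A => ?_⟩
  · have : p + 1 ≤ 5 * d := by omega
    exact_mod_cast this
  · have h := sum_trace_unbiasedPOVM_sq (by omega) hf A
    rw [← (Fintype.equivFin _).symm.sum_comp] at h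
    push_cast
    exact h

theorem POVM.sum_prob_sq {X Ω : Type} [Fintype X] [DecidableEq X] [Fintype Ω] {N : POVM X Ω}
    {L : ℝ} (hN : ∀ A : Matrix X X ℂ,
      ∑ ω, (N.effect ω * A).trace ^ 2 = (A.trace ^ 2 + (A * A).trace) / (L : ℂ) ^ 2)
    {ρ : Matrix X X ℂ} (hρ : ρ ∈ densityOperators X) :
    ∑ ω, N.prob ρ ω ^ 2 ≤ 2 / L ^ 2 := by
  have h := hN ρ
  simp only [← N.ofReal_prob hρ.1] at h
  have h1 := congrArg Complex.re h
  rw [hρ.2, ← Complex.ofReal_pow L, Complex.div_ofReal_re] at h1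
  have h2 := hρ.1.re_trace_mul_self_le
  rw [hρ.2] at h2
  norm_cast at h1
  rw [h1]
  gcongr
  simp at h2 ⊢
  linarith

/-- The difference of two states is traceless, so only the Hilbert–Schmidt term of the design
identity survives. -/
theorem POVM.sum_prob_sub_sq {X Ω : Type} [Fintype X] [DecidableEq X] [Fintype Ω]
    {N : POVM X Ω} {L : ℝ} (hN : ∀ A : Matrix X X ℂ,
      ∑ ω, (N.effect ω * A).trace ^ 2 = (A.trace ^ 2 + (A * A).trace) / (L : ℂ) ^ 2)
    {ρ σ : Matrix X X ℂ} (hρ : ρ ∈ densityOperators X) (hσ : σ ∈ densityOperators X) :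
    ∑ ω, (N.prob ρ ω - N.prob σ ω) ^ 2 = ((ρ - σ) * (ρ - σ)).trace.re / L ^ 2 := by
  have h := hN (ρ - σ)
  simp only [Matrix.mul_sub (N.effect _), Matrix.trace_sub (N.effect _ * _),
    ← N.ofReal_prob hρ.1, ← N.ofReal_prob hσ.1] at h
  have h1 := congrArg Complex.re h
  rw [Matrix.trace_sub ρ σ, hρ.2, hσ.2, ← Complex.ofReal_pow L, Complex.div_ofReal_re] at h1
  norm_cast at h1
  rw [h1]
  simp

theorem POVM.answerProb_tensor_copies {X Ω : Type} [Fintype X] [DecidableEq X] [Fintype Ω]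
    (N : POVM X Ω) {n : ℕ} (decision : (Fin n ⊕ Fin n → Ω) → Bool) {ρ σ : Matrix X X ℂ}
    (hρ : ρ.PosSemidef) (hσ : σ.PosSemidef) (b : Bool) :
    (POVM.tensor fun _ => N).answerProb decision (copies n ρ σ) b =
      ∑ ω with decision ω = b,
        ∏ k, (Sum.elim (fun _ => N.prob ρ) (fun _ => N.prob σ) : _ → Ω → ℝ) k (ω k) := by
  refine Finset.sum_congr rfl fun ω _ => ?_
  rw [copies, POVM.prob_tensor _ (by rintro (k | k) <;> assumption)]
  refine Finset.prod_congr rfl fun k _ => ?_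
  rcases k with k | k <;> rfl

theorem theorem2 :
    ∃ C : ℝ, 0 < C ∧ ∀ (d : ℕ) (ε : ℝ), 0 < ε →
      ∃ n : ℕ, (n : ℝ) ≤ C * ((d : ℝ) ^ 2 / ε ^ 2) ∧
        ∃ (m : ℕ) (M : POVM (Fin n ⊕ Fin n → Fin d) (Fin n ⊕ Fin n → Fin m)),
          M.IsIndependent ∧
          ∃ decision : (Fin n ⊕ Fin n → Fin m) → Bool,
            ∀ ρ ∈ densityOperators (Fin d), ∀ σ ∈ densityOperators (Fin d),
              (ρ = σ → 2 / 3 ≤ M.answerProb decision (copies n ρ σ) true) ∧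
              (ε < traceNorm (ρ - σ) →
                2 / 3 ≤ M.answerProb decision (copies n ρ σ) false) := by
  -- Below, `n = 2 r ≤ 800 u + 2` with `u = d² / ε² ≥ 1 / 2`, hence `n ≤ 804 u`.
  refine ⟨804, by norm_num, fun d ε hε => ?_⟩
  have hnorm : ∀ ρ ∈ densityOperators (Fin d), ∀ σ ∈ densityOperators (Fin d),
      ε < traceNorm (ρ - σ) → ε ^ 2 < d * ((ρ - σ) * (ρ - σ)).trace.re := by
    intro ρ hρ σ hσ h
    have h1 := traceNorm_sub_sq_le hρ hσ
    rw [Fintype.card_fin] at h1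
    exact (pow_lt_pow_left₀ h hε.le two_ne_zero).trans_le h1
  -- Here no two states are `ε`-far, since `‖ρ - σ‖₁² ≤ 2 d`, so "Yes" without any copies is
  -- correct. This case also absorbs `d = 0`, and its exclusion gives `u ≥ 1 / 2`.
  by_cases hlarge : 2 * (d : ℝ) ≤ ε ^ 2
  · refine ⟨0, by simp; positivity, 0, POVM.tensor isEmptyElim, POVM.isIndependent_tensor _,
      fun _ => true, fun ρ hρ σ hσ => ⟨fun _ => ?_, fun h => ?_⟩⟩
    · have h1 : (copies 0 ρ σ).trace = 1 := by
        rw [copies, trace_tensorOp]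
        simp
      simp only [POVM.answerProb, Finset.filter_true, POVM.sum_prob _ h1]
      norm_num
    · have h1 := hnorm ρ hρ σ hσ h
      have h2 := re_trace_sub_mul_self_le hρ hσ
      have h3 : (d : ℝ) * ((ρ - σ) * (ρ - σ)).trace.re ≤ d * 2 := by gcongr
      linarith
  rw [not_le] at hlarge
  have hd : 0 < d := by
    rcases Nat.eq_zero_or_pos d with rfl | h
    · norm_num at hlarge
      linarith [sq_nonneg ε]
    · exact h
  have hd1 : (1 : ℝ) ≤ d := by exact_mod_cast hd
  obtain ⟨L, m, N, hL, hLd, hN⟩ := exists_informationallyComplete_povm hd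
  set u : ℝ := (d : ℝ) ^ 2 / ε ^ 2 with hu
  have hu1 : 1 / 2 ≤ u := by
    rw [hu, le_div_iff₀ (by positivity)]
    nlinarith
  -- The factor is `400 = 80 * 5`: `r L τ = r ε² / (d L) ≥ 400 d / L`, and `L ≤ 5 d`.
  obtain ⟨r, hr1, hr2⟩ : ∃ r : ℕ, 400 * u ≤ r ∧ (r : ℝ) ≤ 400 * u + 1 :=
    ⟨⌈400 * u⌉₊, Nat.le_ceil _, (Nat.ceil_lt_add_one (by positivity)).le⟩
  set τ : ℝ := ε ^ 2 / (d * L ^ 2) with hτdef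
  have hτ : 0 < τ := by positivity
  have hr : 80 ≤ r * L * τ := by
    have h1 : r * L * τ = r * ε ^ 2 / (d * L) := by
      rw [hτdef]
      field_simp
    have h2 : 400 * (d : ℝ) ^ 2 ≤ r * ε ^ 2 := by
      have : 400 * u * ε ^ 2 ≤ r * ε ^ 2 := by gcongr
      rwa [hu, mul_assoc, div_mul_cancel₀ _ (by positivity)] at this
    rw [h1, le_div_iff₀ (by positivity)]
    nlinarith
  refine ⟨r + r, by push_cast; linarith, m, POVM.tensor fun _ => N,
    POVM.isIndependent_tensor _, fun ω => decide (closenessStat r ω < r ^ 2 * τ / 2),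
    fun ρ hρ σ hσ => ⟨?_, fun h => ?_⟩⟩
  · rintro rfl
    rw [POVM.answerProb_tensor_copies N _ hρ.1 hρ.1]
    simp only [decide_eq_true_eq]
    exact closenessTest_of_eq (N.prob_nonneg hρ.1) (N.sum_prob hρ.2) hL hτ
      (POVM.sum_prob_sq hN hρ) hr
  · rw [POVM.answerProb_tensor_copies N _ hρ.1 hσ.1]
    simp only [decide_eq_false_iff_not]
    refine closenessTest_of_le (N.prob_nonneg hρ.1) (N.prob_nonneg hσ.1) (N.sum_prob hρ.2)
      (N.sum_prob hσ.2) hL hτ (POVM.sum_prob_sq hN hρ) (POVM.sum_prob_sq hN hσ) hr ?_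
    rw [POVM.sum_prob_sub_sq hN hρ hσ, hτdef, ← div_div]
    gcongr
    rw [div_le_iff₀' (by positivity)]
    exact (hnorm ρ hρ σ hσ h).le
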